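/- Fix an infinite set $V$ of variables and the signature $\{0, 1, \neg, \wedge, \vee, \Box\}$. Let $\mathrm{K}^{\mathrm{g}}$ be global basic modal logic: for a finite set of formulas $\gamma_1,\dots,\gamma_n$ and a formula $\varphi$ over $V$, $\gamma_1,\dots,\gamma_n \vdash_{\mathrm{K}^{\mathrm{g}}} \varphi$ holds if and only if $\varphi$ is true at every world of each Kripke model in which all of $\gamma_1,\dots,\gamma_n$ are true at every world. A global equational definition of consequence (EDC) for a logic $\mathrm{L}$ with respect to a class of algebras $\mathsf{K}$ is a sequence $(\Theta_n)_{n\in\omega}$ of (possibly infinite) sets of equations $\Theta_n(x_1,\dots,x_n,y)$ in the distinct variables $x_1,\dots,x_n,y$ such that for all $n \in \omega$ and all formulas $\gamma_1,\dots,\gamma_n,\varphi$ $$\gamma_1,\dots,\gamma_n \vdash_{\mathrm{L}} \varphi \iff \mathsf{K} \vDash \Theta_n(\gamma_1,\dots,\gamma_n,\varphi).$$ The EDC is called standard if $\mathsf{K}$ is the algebraic counterpart $\mathrm{Alg}\,\mathrm{L}$ of $\mathrm{L}$, i.e. the class of all algebras $\mathbf{A}$ in the signature such that the identity is the only congruence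 of $\mathbf{A}$ compatible with all $\mathrm{L}$-filters on $\mathbf{A}$. (An $\mathrm{L}$-filter is a subset $F \subseteq \mathbf{A}$ such that, for each rule $\gamma_1,\dots,\gamma_n \vdash_{\mathrm{L}} \varphi$ and each homomorphism $h$ from the formula algebra to $\mathbf{A}$, $h(\gamma_1),\dots,h(\gamma_n)\in F$ implies $h(\varphi)\in F$; a congruence $\theta$ is compatible with $F$ if $a \in F$ and $\langle a,b\rangle\in\theta$ imply $b\in F$.) For $\mathrm{K}^{\mathrm{g}}$ this class is known to be the variety $\mathsf{BAO}$ of Boolean algebras with a unary operation $\Box$ satisfying $\Box(x\wedge y)\approx\Box x\wedge\Box y$ and $\Box 1\approx 1$. Then $\mathrm{K}^{\mathrm{g}}$ has no standard global EDC: it has no global EDC with respect to $\mathrm{Alg}\,\mathrm{K}^{\mathrm{g}}$, and no global EDC with respect to $\mathsf{BAO}$. -/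

import Mathlib

universe u v w

namespace ModalEDC

/-- Formulas (equivalently terms) of the basic modal language `⟨0, 1, ¬, ∧, ∨, □⟩` over the
variables `X`. -/
inductive Fm (X : Type u) : Type u
  | var : X → Fm X
  | bot : Fm X
  | top : Fm X
  | neg : Fm X → Fm X
  | and : Fm X → Fm X → Fm X
  | or : Fm X → Fm X → Fm X
  | box : Fm X → Fm X

/-- Algebras in the signature `⟨0, 1, ¬, ∧, ∨, □⟩`; no equations are required here. -/
class ModalAlg (A : Type w) where
  bot : A
  top : A
  neg : A → A
  and : A → A → A
  or : A → A → A
  box : A → A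

/-- The formula algebra: the absolutely free algebra over `X`. -/
instance instModalAlgFm (X : Type u) : ModalAlg (Fm X) where
  bot := Fm.bot
  top := Fm.top
  neg := Fm.neg
  and := Fm.and
  or := Fm.or
  box := Fm.box

/-- The unique homomorphism from the formula algebra to `A` that extends `h`. For `A = Fm Y` this
is the substitution given by `h`. -/
def Fm.eval {X : Type u} {A : Type w} [ModalAlg A] (h : X → A) : Fm X → A
  | .var x => h x
  | .bot => ModalAlg.bot
  | .top => ModalAlg.top
  | .neg φ => ModalAlg.neg (φ.eval h)
  | .and φ ψ => ModalAlg.and (φ.eval h) (ψ.eval h)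
  | .or φ ψ => ModalAlg.or (φ.eval h) (ψ.eval h)
  | .box φ => ModalAlg.box (φ.eval h)

/-- Classes of algebras in the modal signature. -/
def AlgClass := ∀ (A : Type w) [ModalAlg A], Prop

/-- Boolean algebras with an operator: the operations `0, 1, ¬, ∧, ∨` are those of a Boolean
algebra, and `□` preserves binary meets and the top element. -/
def BAO : AlgClass.{w} := fun A _ =>
  ∃ _ : BooleanAlgebra A,
    (ModalAlg.bot : A) = ⊥ ∧ (ModalAlg.top : A) = ⊤ ∧
    (∀ a : A, ModalAlg.neg a = aᶜ) ∧
    (∀ a b : A, ModalAlg.and a b = a ⊓ b) ∧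
    (∀ a b : A, ModalAlg.or a b = a ⊔ b) ∧
    (∀ a b : A, ModalAlg.box (a ⊓ b) = ModalAlg.box a ⊓ ModalAlg.box b) ∧
    ModalAlg.box (⊤ : A) = ⊤

open Classical in
/-- A logic in the modal signature over the variables `V`: a finitary structural consequence
relation, given as a set of rules with finitely many premises. -/
structure Logic (V : Type u) where
  Entails : Finset (Fm V) → Fm V → Prop
  refl : ∀ (Γ : Finset (Fm V)) (φ : Fm V), φ ∈ Γ → Entails Γ φ
  cut : ∀ (Γ Δ : Finset (Fm V)) (φ ψ : Fm V),
    Entails Γ ψ → Entails (insert ψ Δ) φ → Entails (Γ ∪ Δ) φ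
  structural : ∀ (Γ : Finset (Fm V)) (φ : Fm V) (σ : V → Fm V),
    Entails Γ φ → Entails (Γ.image (Fm.eval σ)) (φ.eval σ)

/-- The `L`-filters on an algebra: the subsets closed under all rules of `L`. -/
def Logic.IsFilter {V : Type u} (L : Logic V) {A : Type w} [ModalAlg A] (F : Set A) : Prop :=
  ∀ (Γ : Finset (Fm V)) (φ : Fm V), L.Entails Γ φ →
    ∀ h : V → A, (∀ γ ∈ Γ, γ.eval h ∈ F) → φ.eval h ∈ F

/-- Congruences of an algebra. -/
def IsCongruence {A : Type w} [ModalAlg A] (θ : Setoid A) : Prop :=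
  (∀ a b : A, θ a b → θ (ModalAlg.neg a) (ModalAlg.neg b)) ∧
  (∀ a b c d : A, θ a b → θ c d → θ (ModalAlg.and a c) (ModalAlg.and b d)) ∧
  (∀ a b c d : A, θ a b → θ c d → θ (ModalAlg.or a c) (ModalAlg.or b d)) ∧
  (∀ a b : A, θ a b → θ (ModalAlg.box a) (ModalAlg.box b))

/-- An equivalence relation is compatible with `F` if it does not cut across `F`. -/
def Compatible {A : Type w} (θ : Setoid A) (F : Set A) : Prop :=
  ∀ a b : A, a ∈ F → θ a b → b ∈ F

/-- The algebraic counterpart of `L`: the algebras on which only the identity congruence is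
compatible with all `L`-filters. -/
def Logic.Alg {V : Type u} (L : Logic V) : AlgClass.{w} := fun A _ =>
  ∀ θ : Setoid A, IsCongruence θ → (∀ F : Set A, L.IsFilter F → Compatible θ F) → θ = ⊥

/-- The variables `x₁, …, xₙ, y`. -/
abbrev EqVar (n : ℕ) := Fin n ⊕ Unit

/-- `K ⊨ Θ(γ₁, …, γₙ, φ)` for a set `Θ(x₁, …, xₙ, y)` of equations. -/
def Satisfies {V : Type u} (K : AlgClass.{w}) {n : ℕ} (Θ : Set (Fm (EqVar n) × Fm (EqVar n)))
    (γ : Fin n → Fm V) (φ : Fm V) : Prop :=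
  ∀ ε ∈ Θ, ∀ (A : Type w) [ModalAlg A], K A → ∀ h : V → A,
    (ε.1.eval (Sum.elim γ fun _ => φ)).eval h = (ε.2.eval (Sum.elim γ fun _ => φ)).eval h

open Classical in
/-- `Ψ` is a local equational definition of consequence for `L` with respect to `K`. -/
def Logic.IsLocalEDC {V : Type u} (L : Logic V) (K : AlgClass.{w})
    (Ψ : ∀ n : ℕ, Set (Set (Fm (EqVar n) × Fm (EqVar n)))) : Prop :=
  ∀ (n : ℕ) (γ : Fin n → Fm V) (φ : Fm V),
    L.Entails (Finset.univ.image γ) φ ↔ ∃ Θ ∈ Ψ n, Satisfies K Θ γ φ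

/-- `L` has a global equational definition of consequence with respect to `K`. -/
def Logic.HasGlobalEDC {V : Type u} (L : Logic V) (K : AlgClass.{w}) : Prop :=
  ∃ Θ : ∀ n : ℕ, Set (Fm (EqVar n) × Fm (EqVar n)), L.IsLocalEDC K fun n => {Θ n}

/-- `L` has a standard global equational definition of consequence: one with respect to its
algebraic counterpart. -/
def Logic.HasStandardGlobalEDC {V : Type u} (L : Logic V) : Prop :=
  L.HasGlobalEDC (Logic.Alg.{u, w} L)

/-- Truth of a formula at a world of a Kripke model. -/
def Sat {V : Type u} {W : Type w} (R : W → W → Prop) (val : V → Set W) : W → Fm V → Prop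
  | a, .var x => a ∈ val x
  | _, .bot => False
  | _, .top => True
  | a, .neg φ => ¬ Sat R val a φ
  | a, .and φ ψ => Sat R val a φ ∧ Sat R val a ψ
  | a, .or φ ψ => Sat R val a φ ∨ Sat R val a ψ
  | a, .box φ => ∀ b, R a b → Sat R val b φ

theorem sat_eval {V : Type u} {X : Type v} {W : Type w} (R : W → W → Prop) (val : V → Set W)
    (σ : X → Fm V) (φ : Fm X) (a : W) :
    Sat R val a (φ.eval σ) ↔ Sat R (fun x => {b | Sat R val b (σ x)}) a φ := by
  induction φ generalizing a with
  | var x => exact Iff.rfl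
  | bot => exact Iff.rfl
  | top => exact Iff.rfl
  | neg φ ih => exact not_congr (ih a)
  | and φ ψ ih₁ ih₂ => exact and_congr (ih₁ a) (ih₂ a)
  | or φ ψ ih₁ ih₂ => exact or_congr (ih₁ a) (ih₂ a)
  | box φ ih => exact forall_congr' fun b => imp_congr_right fun _ => ih b

open Classical in
/-- Global basic modal logic: `Γ ⊢ φ` if `φ` is true at every world of each Kripke model in which
all members of `Γ` are true at every world. -/
def globalK (V : Type u) : Logic V where
  Entails Γ φ := ∀ (W : Type w) [Nonempty W] (R : W → W → Prop) (val : V → Set W),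
    (∀ γ ∈ Γ, ∀ a, Sat R val a γ) → ∀ a, Sat R val a φ
  refl Γ φ hφ W _ R val hΓ a := hΓ φ hφ a
  cut Γ Δ φ ψ h₁ h₂ W _ R val hΓΔ := by
    refine h₂ W R val fun γ hγ => ?_
    rcases Finset.mem_insert.1 hγ with rfl | hγ
    · exact h₁ W R val fun δ hδ => hΓΔ δ (Finset.mem_union_left _ hδ)
    · exact hΓΔ γ (Finset.mem_union_right _ hγ)
  structural Γ φ σ h W _ R val hΓ a := by
    refine (sat_eval R val σ φ a).2 (h W R _ (fun γ hγ b => ?_) a)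
    exact (sat_eval R val σ γ b).1 (hΓ _ (Finset.mem_image_of_mem _ hγ) b)

end ModalEDC

namespace ModalEDC

/-! Globally `◇1 ⊬ 0`, so some equation of `Θ 1` fails at `(◇1, 0)`, hence already at a world of a
Kripke model. An equation sees only finitely many steps, so unravelling the model to a large depth
`n` preserves the failure (`exists_sat_layeredRel_iff`). There `□ⁿ⁺¹0` is true everywhere, so `◇1`
and `◇1 ∧ □ⁿ⁺¹0` have the same truth set, and the equation also fails at `(◇1 ∧ □ⁿ⁺¹0, 0)`. But
globally `◇1 ∧ □ⁿ⁺¹0 ⊢ 0`, since seriality yields paths of every length: a contradiction.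

The argument needs only a class that validates all `K`-equivalences and contains the complex
algebras; both classes are shown to qualify. -/

theorem eval_eval {X : Type u} {Y : Type v} {A : Type w} [ModalAlg A] (σ : X → Fm Y) (h : Y → A)
    (φ : Fm X) : (φ.eval σ).eval h = φ.eval fun x => (σ x).eval h := by
  induction φ with
  | var x => rfl
  | bot => rfl
  | top => rfl
  | neg φ ih => exact congrArg ModalAlg.neg ih
  | and φ ψ ih₁ ih₂ => exact congrArg₂ ModalAlg.and ih₁ ih₂
  | or φ ψ ih₁ ih₂ => exact congrArg₂ ModalAlg.or ih₁ ih₂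
  | box φ ih => exact congrArg ModalAlg.box ih

/-- `φ` and `ψ` are true at the same worlds of all Kripke models. -/
def KEquiv {V : Type u} (φ ψ : Fm V) : Prop :=
  ∀ (W : Type w) (R : W → W → Prop) (val : V → Set W) (a : W), Sat R val a φ ↔ Sat R val a ψ

/-! ### Complex algebras -/

/-- The complex algebra of a Kripke frame. -/
abbrev complexAlg {W : Type w} (R : W → W → Prop) : ModalAlg (Set W) where
  bot := ∅
  top := Set.univ
  neg := fun s => sᶜ
  and := fun s t => s ∩ t
  or := fun s t => s ∪ t
  box := fun s => {a | ∀ b, R a b → b ∈ s}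

theorem mem_eval_complexAlg {V : Type u} {W : Type w} (R : W → W → Prop) (val : V → Set W)
    (φ : Fm V) (a : W) : a ∈ @Fm.eval V (Set W) (complexAlg R) val φ ↔ Sat R val a φ := by
  induction φ generalizing a with
  | var x => exact Iff.rfl
  | bot => exact Iff.rfl
  | top => exact iff_true_intro trivial
  | neg φ ih => exact not_congr (ih a)
  | and φ ψ ih₁ ih₂ => exact and_congr (ih₁ a) (ih₂ a)
  | or φ ψ ih₁ ih₂ => exact or_congr (ih₁ a) (ih₂ a)
  | box φ ih => exact forall_congr' fun b => imp_congr_right fun _ => ih b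

theorem bao_complexAlg {W : Type w} (R : W → W → Prop) : @BAO (Set W) (complexAlg R) := by
  refine ⟨inferInstance, rfl, rfl, fun _ => rfl, fun _ _ => rfl, fun _ _ => rfl, fun s t => ?_, ?_⟩
  · ext a
    exact ⟨fun h => ⟨fun b hb => (h b hb).1, fun b hb => (h b hb).2⟩,
      fun h b hb => ⟨h.1 b hb, h.2 b hb⟩⟩
  · exact Set.eq_univ_of_forall fun _ _ _ => trivial

/-- Global consequence preserves truth at all worlds, so the singleton of the top element is a
filter, and it alone already separates points. -/
theorem alg_complexAlg (V : Type u) {W : Type w} [Nonempty W] (R : W → W → Prop) :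
    @Logic.Alg V (globalK.{u, w} V) (Set W) (complexAlg R) := by
  let _ := complexAlg R
  intro θ hθ hF
  have hfilter : (globalK.{u, w} V).IsFilter ({Set.univ} : Set (Set W)) := by
    intro Γ φ h val hΓ
    refine Set.eq_univ_of_forall fun a => (mem_eval_complexAlg R val φ a).2 ?_
    refine h W R val (fun γ hγ b => (mem_eval_complexAlg R val γ b).1 ?_) a
    rw [Set.mem_singleton_iff.1 (hΓ γ hγ)]
    trivial
  have hsub : ∀ s t : Set W, θ s t → s ⊆ t := by
    intro s t hst
    -- The implication `s → s` is the top, so compatibility forces `s → t` to be the top.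
    have h : θ (sᶜ ∪ s) (sᶜ ∪ t) := hθ.2.2.1 _ _ _ _ (θ.refl _) hst
    have h' : sᶜ ∪ t = Set.univ := hF _ hfilter _ _ (Set.compl_union_self s) h
    intro a ha
    exact ((Set.ext_iff.1 h' a).2 trivial).resolve_left fun hn => hn ha
  ext s t
  exact ⟨fun h => (hsub s t h).antisymm (hsub t s (θ.symm h)), fun h => h ▸ θ.refl s⟩

/-! ### Algebras in the algebraic counterpart validate `K`-equivalences -/

theorem exists_finset_eval_congr {X : Type u} (φ : Fm X) :
    ∃ S : Set X, S.Finite ∧ ∀ (A : Type w) [ModalAlg A] (h k : X → A),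
      (∀ x ∈ S, h x = k x) → φ.eval h = φ.eval k := by
  induction φ with
  | var x => exact ⟨{x}, Set.finite_singleton x, fun A _ h k hk => hk x rfl⟩
  | bot => exact ⟨∅, Set.finite_empty, fun A _ h k _ => rfl⟩
  | top => exact ⟨∅, Set.finite_empty, fun A _ h k _ => rfl⟩
  | neg φ ih =>
    obtain ⟨S, hS, h⟩ := ih
    exact ⟨S, hS, fun A _ f g hfg => congrArg ModalAlg.neg (h A f g hfg)⟩
  | box φ ih =>
    obtain ⟨S, hS, h⟩ := ih
    exact ⟨S, hS, fun A _ f g hfg => congrArg ModalAlg.box (h A f g hfg)⟩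
  | and φ ψ ih₁ ih₂ =>
    obtain ⟨S, hS, h₁⟩ := ih₁
    obtain ⟨T, hT, h₂⟩ := ih₂
    exact ⟨S ∪ T, hS.union hT, fun A _ f g hfg => congrArg₂ ModalAlg.and
      (h₁ A f g fun x hx => hfg x (.inl hx)) (h₂ A f g fun x hx => hfg x (.inr hx))⟩
  | or φ ψ ih₁ ih₂ =>
    obtain ⟨S, hS, h₁⟩ := ih₁
    obtain ⟨T, hT, h₂⟩ := ih₂
    exact ⟨S ∪ T, hS.union hT, fun A _ f g hfg => congrArg₂ ModalAlg.or
      (h₁ A f g fun x hx => hfg x (.inl hx)) (h₂ A f g fun x hx => hfg x (.inr hx))⟩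

/-- Rules are stated over `V`, while `A` may be larger; an infinite `V` still has distinct names for
the finitely many elements that occur in given terms. -/
theorem exists_rename {V : Type u} [Infinite V] {A : Type w} [ModalAlg A] {S : Set A}
    (hS : S.Finite) : ∃ (f : A → V) (h : V → A), ∀ a ∈ S, h (f a) = a := by
  classical
  have : Finite S := hS
  obtain ⟨n, ⟨i⟩⟩ := Finite.exists_equiv_fin S
  let e : S → V := fun s => Infinite.natEmbedding V (i s)
  have he : Function.Injective e := fun s t hst =>
    i.injective (Fin.ext ((Infinite.natEmbedding V).injective hst))
  refine ⟨fun a => if ha : a ∈ S then e ⟨a, ha⟩ else Infinite.natEmbedding V 0,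
    Function.extend e Subtype.val fun _ => ModalAlg.bot, fun a ha => ?_⟩
  simp only [dif_pos ha]
  exact he.extend_apply _ _ _

/-- The values of `K`-equivalent terms lie in the same filters of the global modal logic. -/
theorem KEquiv.mem_of_mem {V : Type u} [Infinite V] {A : Type w} [ModalAlg A] {F : Set A}
    (hF : (globalK.{u, w} V).IsFilter F) {φ ψ : Fm A} (h : KEquiv.{w, w} φ ψ)
    (hφ : φ.eval id ∈ F) : ψ.eval id ∈ F := by
  classical
  obtain ⟨S, hS, hφS⟩ := exists_finset_eval_congr.{w, w} φ
  obtain ⟨T, hT, hψT⟩ := exists_finset_eval_congr.{w, w} ψ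
  obtain ⟨f, g, hfg⟩ := exists_rename (V := V) (hS.union hT)
  have hentails : (globalK.{u, w} V).Entails {φ.eval fun a => Fm.var (f a)}
      (ψ.eval fun a => Fm.var (f a)) := by
    intro W _ R val hΓ a
    rw [sat_eval, ← h, ← sat_eval]
    exact hΓ _ (Finset.mem_singleton_self _) a
  have key := hF _ _ hentails g
  have hψ : (ψ.eval fun a => Fm.var (f a)).eval g = ψ.eval id :=
    (eval_eval _ _ _).trans (hψT A _ id fun a ha => hfg a (.inr ha))
  rw [hψ] at key
  refine key fun γ hγ => ?_
  have hγφ : (φ.eval fun a => Fm.var (f a)).eval g = φ.eval id :=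
    (eval_eval _ _ _).trans (hφS A _ id fun a ha => hfg a (.inl ha))
  rwa [Finset.mem_singleton.1 hγ, hγφ]

/-- The pairs of values of `K`-equivalent terms. -/
def KRel {A : Type w} [ModalAlg A] (a b : A) : Prop :=
  ∃ φ ψ : Fm A, KEquiv.{w, w} φ ψ ∧ φ.eval id = a ∧ ψ.eval id = b

theorem KRel.refl {A : Type w} [ModalAlg A] (a : A) : KRel a a :=
  ⟨.var a, .var a, fun _ _ _ _ => Iff.rfl, rfl, rfl⟩

/-- Reflexivity allows one argument to change at a time along a chain. -/
theorem eqvGen_map₂ {A : Type w} {r : A → A → Prop} (hr : ∀ a, r a a) (op : A → A → A)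
    (hop : ∀ a b c d, r a b → r c d → r (op a c) (op b d)) {a b c d : A}
    (hab : Relation.EqvGen r a b) (hcd : Relation.EqvGen r c d) :
    Relation.EqvGen r (op a c) (op b d) := by
  have h₁ : Relation.EqvGen r (op a c) (op b c) := by
    induction hab with
    | rel x y h => exact .rel _ _ (hop _ _ _ _ h (hr c))
    | refl x => exact .refl _
    | symm x y _ ih => exact ih.symm
    | trans x y z _ _ ih₁ ih₂ => exact ih₁.trans _ _ _ ih₂
  have h₂ : Relation.EqvGen r (op b c) (op b d) := by
    clear h₁
    induction hcd with
    | rel x y h => exact .rel _ _ (hop _ _ _ _ (hr b) h)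
    | refl x => exact .refl _
    | symm x y _ ih => exact ih.symm
    | trans x y z _ _ ih₁ ih₂ => exact ih₁.trans _ _ _ ih₂
  exact h₁.trans _ _ _ h₂

theorem isCongruence_eqvGen_kRel (A : Type w) [ModalAlg A] :
    IsCongruence (Relation.EqvGen.setoid (KRel (A := A))) := by
  -- Unary operations carry a dummy second argument so that `eqvGen_map₂` covers them.
  have hneg : ∀ a b c d : A, KRel a b → KRel c d → KRel (ModalAlg.neg a) (ModalAlg.neg b) := by
    rintro _ _ _ _ ⟨φ, ψ, h, rfl, rfl⟩ -
    exact ⟨.neg φ, .neg ψ, fun W R val a => not_congr (h W R val a), rfl, rfl⟩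
  have hbox : ∀ a b c d : A, KRel a b → KRel c d → KRel (ModalAlg.box a) (ModalAlg.box b) := by
    rintro _ _ _ _ ⟨φ, ψ, h, rfl, rfl⟩ -
    exact ⟨.box φ, .box ψ, fun W R val a =>
      forall_congr' fun b => imp_congr_right fun _ => h W R val b, rfl, rfl⟩
  have hand : ∀ a b c d : A, KRel a b → KRel c d →
      KRel (ModalAlg.and a c) (ModalAlg.and b d) := by
    rintro _ _ _ _ ⟨φ, ψ, h, rfl, rfl⟩ ⟨φ', ψ', h', rfl, rfl⟩
    exact ⟨.and φ φ', .and ψ ψ', fun W R val a => and_congr (h W R val a) (h' W R val a), rfl, rfl⟩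
  have hor : ∀ a b c d : A, KRel a b → KRel c d →
      KRel (ModalAlg.or a c) (ModalAlg.or b d) := by
    rintro _ _ _ _ ⟨φ, ψ, h, rfl, rfl⟩ ⟨φ', ψ', h', rfl, rfl⟩
    exact ⟨.or φ φ', .or ψ ψ', fun W R val a => or_congr (h W R val a) (h' W R val a), rfl, rfl⟩
  exact ⟨fun a b h => eqvGen_map₂ KRel.refl (fun x _ => ModalAlg.neg x) hneg h (.refl a),
    fun a b c d h h' => eqvGen_map₂ KRel.refl ModalAlg.and hand h h',
    fun a b c d h h' => eqvGen_map₂ KRel.refl ModalAlg.or hor h h',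
    fun a b h => eqvGen_map₂ KRel.refl (fun x _ => ModalAlg.box x) hbox h (.refl a)⟩

/-- The congruence generated by `KRel` is compatible with every filter, so it is the identity. -/
theorem KEquiv.eval_eq_of_alg {V : Type u} [Infinite V] {A : Type w} [ModalAlg A]
    (hA : (globalK.{u, w} V).Alg A) (h : V → A) {φ ψ : Fm V} (hφψ : KEquiv.{u, w} φ ψ) :
    φ.eval h = ψ.eval h := by
  have hbot := hA _ (isCongruence_eqvGen_kRel A) fun F hF => by
    have hiff : ∀ a b : A, Relation.EqvGen KRel a b → (a ∈ F ↔ b ∈ F) := by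
      intro a b hab
      induction hab with
      | rel x y hxy =>
        obtain ⟨φ, ψ, h, rfl, rfl⟩ := hxy
        exact ⟨h.mem_of_mem hF, KEquiv.mem_of_mem hF fun W R val a => (h W R val a).symm⟩
      | refl x => exact Iff.rfl
      | symm x y _ ih => exact ih.symm
      | trans x y z _ _ ih₁ ih₂ => exact ih₁.trans ih₂
    exact fun a b ha hab => (hiff a b hab).1 ha
  have hrel : KRel (φ.eval h) (ψ.eval h) := by
    refine ⟨φ.eval fun x => .var (h x), ψ.eval fun x => .var (h x), fun W R val a => ?_,
      eval_eval _ _ _, eval_eval _ _ _⟩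
    rw [sat_eval, sat_eval]
    exact hφψ _ _ _ _
  have : Relation.EqvGen.setoid KRel (φ.eval h) (ψ.eval h) := .rel _ _ hrel
  rw [hbot] at this
  exact this

/-! ### Boolean algebras with an operator validate `K`-equivalences -/

section Canonical

variable {A : Type w} [BooleanAlgebra A]

/-- The canonical accessibility relation between prime ideals (complements of ultrafilters). -/
def canonicalRel (box : A → A) (I J : {I : Order.Ideal A // I.IsPrime}) : Prop :=
  ∀ a, box a ∉ I.1 → a ∉ J.1

/-- Jónsson–Tarski existence lemma: if `box a ∈ I`, the filter of all `b` with `box b ∉ I` misses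
the ideal below `a`, and a prime ideal separating them is the required successor. -/
theorem box_notMem_iff {box : A → A} (hinf : ∀ a b, box (a ⊓ b) = box a ⊓ box b)
    (htop : box ⊤ = ⊤) (I : {I : Order.Ideal A // I.IsPrime}) (a : A) :
    box a ∉ I.1 ↔ ∀ J, canonicalRel box I J → a ∉ J.1 := by
  refine ⟨fun h J hJ => hJ a h, fun h ha => ?_⟩
  have hmono : ∀ b c, b ≤ c → box b ≤ box c := fun b c hbc => by
    rw [← inf_eq_left.2 hbc, hinf]
    exact inf_le_right
  have hF : Order.IsPFilter {b | box b ∉ I.1} := by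
    refine Order.IsPFilter.of_def ⟨⊤, ?_⟩ ?_ ?_
    · rw [Set.mem_ofPred_eq, htop]
      exact I.2.toIsProper.top_notMem
    · intro b hb c hc
      refine ⟨b ⊓ c, ?_, inf_le_left, inf_le_right⟩
      rw [Set.mem_ofPred_eq, hinf]
      exact fun hbc => (I.2.mem_or_mem hbc).elim hb hc
    · exact fun hbc hb hc => hb (I.1.lower (hmono _ _ hbc) hc)
  have hdisj : Disjoint (hF.toPFilter : Set A) (Order.Ideal.principal a : Set A) :=
    Set.disjoint_left.2 fun b hb hba => hb (I.1.lower (hmono b a hba) ha)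
  obtain ⟨J, hJ, haJ, hFJ⟩ := DistribLattice.prime_ideal_of_disjoint_filter_ideal hdisj
  exact h ⟨J, hJ⟩ (fun b hb => Set.disjoint_left.1 hFJ hb) (haJ (le_refl a))

theorem exists_isPrime_separating {a b : A} (h : ¬ a ≤ b) :
    ∃ I : {I : Order.Ideal A // I.IsPrime}, a ∉ I.1 ∧ b ∈ I.1 := by
  have hdisj : Disjoint (Order.PFilter.principal a : Set A) (Order.Ideal.principal b : Set A) :=
    Set.disjoint_left.2 fun c hc hcb => h (le_trans hc hcb)
  obtain ⟨J, hJ, hbJ, hFJ⟩ := DistribLattice.prime_ideal_of_disjoint_filter_ideal hdisj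
  exact ⟨⟨J, hJ⟩, Set.disjoint_left.1 hFJ (le_refl a), hbJ (le_refl b)⟩

end Canonical

/-- Truth lemma for the canonical frame: distinct values would be separated by a prime ideal, that
is, by a world. -/
theorem KEquiv.eval_eq_of_bao {V : Type u} {A : Type w} [ModalAlg A] (hA : BAO A) (h : V → A)
    {φ ψ : Fm V} (hφψ : KEquiv.{u, w} φ ψ) : φ.eval h = ψ.eval h := by
  obtain ⟨_, hbot, htop, hneg, hand, hor, hinf, hone⟩ := hA
  have truth : ∀ (χ : Fm V) (I : {I : Order.Ideal A // I.IsPrime}),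
      Sat (canonicalRel ModalAlg.box) (fun x => {I | h x ∉ I.1}) I χ ↔ χ.eval h ∉ I.1 := by
    intro χ
    induction χ with
    | var x => exact fun I => Iff.rfl
    | bot =>
      intro I
      simp only [Sat, Fm.eval, hbot, Order.Ideal.bot_mem, not_true]
    | top =>
      intro I
      simp only [Sat, Fm.eval, htop, I.2.toIsProper.top_notMem, not_false_iff]
    | neg χ ih =>
      intro I
      simp only [Sat, Fm.eval, hneg, ih]
      refine ⟨fun h₁ h₂ => I.2.toIsProper.top_notMem ?_, fun h₁ h₂ => ?_⟩
      · rw [← sup_compl_eq_top (x := χ.eval h)]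
        exact Order.Ideal.sup_mem (not_not.1 h₁) h₂
      · exact (I.2.mem_or_compl_mem).elim h₂ h₁
    | and χ ξ ih₁ ih₂ =>
      intro I
      simp only [Sat, Fm.eval, hand, ih₁, ih₂]
      exact ⟨fun hn hm => (I.2.mem_or_mem hm).elim hn.1 hn.2,
        fun hn => ⟨fun hm => hn (I.1.lower inf_le_left hm),
          fun hm => hn (I.1.lower inf_le_right hm)⟩⟩
    | or χ ξ ih₁ ih₂ =>
      intro I
      simp only [Sat, Fm.eval, hor, ih₁, ih₂, Order.Ideal.sup_mem_iff, not_and_or]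
    | box χ ih =>
      intro I
      simp only [Sat, Fm.eval, ih]
      exact (box_notMem_iff hinf hone I _).symm
  have hle : ∀ {φ ψ : Fm V}, KEquiv.{u, w} φ ψ → φ.eval h ≤ ψ.eval h := by
    intro φ ψ hφψ
    by_contra hn
    obtain ⟨I, hφ, hψ⟩ := exists_isPrime_separating hn
    exact (truth ψ I).1 ((hφψ _ _ _ I).1 ((truth φ I).2 hφ)) hψ
  exact (hle hφψ).antisymm (hle fun W R val a => (hφψ W R val a).symm)

/-! ### Frames of bounded depth -/

/-- The unravelling of `R` into layers `n, n - 1, …, 0`; the worlds of layer `0` are dead ends. -/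
def layeredRel {W : Type w} (R : W → W → Prop) (n : ℕ) (p q : W × ℕ) : Prop :=
  R p.1 q.1 ∧ p.2 = q.2 + 1 ∧ p.2 ≤ n

/-- The bound `m` is the modal depth: from layer `i ≥ m` evaluation never notices the dead ends at
layer `0`. -/
theorem exists_sat_layeredRel_iff {V : Type u} {W : Type w} (R : W → W → Prop)
    (val : V → Set W) (φ : Fm V) : ∃ m, ∀ n i, m ≤ i → i ≤ n → ∀ a,
      Sat (layeredRel R n) (fun x => {p | p.1 ∈ val x}) (a, i) φ ↔ Sat R val a φ := by
  induction φ with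
  | var x => exact ⟨0, fun _ _ _ _ _ => Iff.rfl⟩
  | bot => exact ⟨0, fun _ _ _ _ _ => Iff.rfl⟩
  | top => exact ⟨0, fun _ _ _ _ _ => Iff.rfl⟩
  | neg φ ih =>
    obtain ⟨m, hm⟩ := ih
    exact ⟨m, fun n i hi hn a => not_congr (hm n i hi hn a)⟩
  | and φ ψ ih₁ ih₂ =>
    obtain ⟨m, hm⟩ := ih₁
    obtain ⟨k, hk⟩ := ih₂
    exact ⟨max m k, fun n i hi hn a => and_congr (hm n i (le_of_max_le_left hi) hn a)
      (hk n i (le_of_max_le_right hi) hn a)⟩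
  | or φ ψ ih₁ ih₂ =>
    obtain ⟨m, hm⟩ := ih₁
    obtain ⟨k, hk⟩ := ih₂
    exact ⟨max m k, fun n i hi hn a => or_congr (hm n i (le_of_max_le_left hi) hn a)
      (hk n i (le_of_max_le_right hi) hn a)⟩
  | box φ ih =>
    obtain ⟨m, hm⟩ := ih
    refine ⟨m + 1, fun n i hi hn a => ⟨fun h b hb => ?_, ?_⟩⟩
    · exact (hm n (i - 1) (by omega) (by omega) b).1 (h (b, i - 1) ⟨hb, by simp only; omega, hn⟩)
    · rintro h ⟨b, j⟩ ⟨hb, hj, -⟩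
      simp only at hb hj
      exact (hm n j (by omega) (by omega) b).2 (h b hb)

/-- The formula `□ⁿ0`: every path has fewer than `n` steps. -/
def boxBot {V : Type u} : ℕ → Fm V
  | 0 => .bot
  | n + 1 => .box (boxBot n)

theorem sat_boxBot_layeredRel {V : Type u} {W : Type w} (R : W → W → Prop) (n : ℕ)
    (val : V → Set (W × ℕ)) (p : W × ℕ) : Sat (layeredRel R n) val p (boxBot (n + 1)) := by
  have h : ∀ k (p : W × ℕ), p.2 < k → Sat (layeredRel R n) val p (boxBot k) := by
    intro k
    induction k with
    | zero => exact fun p hp => absurd hp (Nat.not_lt_zero _)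
    | succ k ih => exact fun p hp q hq => ih q (by have := hq.2.1; omega)
  -- Worlds above layer `n` have no successors; any successor lies strictly below layer `n`.
  rintro q ⟨-, hq, hn⟩
  exact h n q (by omega)

theorem not_sat_boxBot {V : Type u} {W : Type w} (R : W → W → Prop) (val : V → Set W)
    (hR : ∀ a, ∃ b, R a b) (n : ℕ) (a : W) : ¬ Sat R val a (boxBot n) := by
  induction n generalizing a with
  | zero => exact id
  | succ n ih =>
    obtain ⟨b, hb⟩ := hR a
    exact fun h => ih b (h b hb)

/-! ### The main argument -/

/-- The formula `◇1`. -/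
def diaTop {V : Type u} : Fm V := .neg (.box .bot)

theorem sat_diaTop {V : Type u} {W : Type w} {R : W → W → Prop} {val : V → Set W} {a : W} :
    Sat R val a diaTop ↔ ∃ b, R a b := by
  simp only [diaTop, Sat, imp_false, not_forall, not_not]

/-- A class of algebras that validates all `K`-equivalences and contains all complex algebras does
not support a global equational definition of consequence for global modal logic. -/
theorem not_hasGlobalEDC (V : Type u) (K : AlgClass.{w})
    (hsound : ∀ (A : Type w) [ModalAlg A], K A → ∀ (h : V → A) (φ ψ : Fm V),
      KEquiv.{u, w} φ ψ → φ.eval h = ψ.eval h)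
    (hcomplex : ∀ (W : Type w) [Nonempty W] (R : W → W → Prop), @K (Set W) (complexAlg R)) :
    ¬ (globalK.{u, w} V).HasGlobalEDC K := by
  classical
  rintro ⟨Θ, hΘ⟩
  have hnot : ¬ Satisfies K (Θ 1) (fun _ => (diaTop : Fm V)) .bot := by
    intro hsat
    -- The single reflexive world refutes `◇1 ⊢ 0`.
    refine (hΘ 1 (fun _ => diaTop) .bot).2 ⟨_, rfl, hsat⟩ PUnit (fun _ _ => True) (fun _ => ∅) ?_ ⟨⟩
    intro γ hγ a
    obtain ⟨_, -, rfl⟩ := Finset.mem_image.1 hγ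
    exact sat_diaTop.2 ⟨⟨⟩, trivial⟩
  obtain ⟨ε, hε, hne⟩ : ∃ ε ∈ Θ 1, ¬ KEquiv.{u, w}
      (ε.1.eval (Sum.elim (fun _ => (diaTop : Fm V)) fun _ => .bot))
      (ε.2.eval (Sum.elim (fun _ => diaTop) fun _ => .bot)) := by
    by_contra! hall
    exact hnot fun ε hε A _ hA h => hsound A hA h _ _ (hall ε hε)
  apply hne
  intro W R val a
  obtain ⟨m₁, hm₁⟩ := exists_sat_layeredRel_iff R val
    (ε.1.eval (Sum.elim (fun _ => (diaTop : Fm V)) fun _ => .bot))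
  obtain ⟨m₂, hm₂⟩ := exists_sat_layeredRel_iff R val
    (ε.2.eval (Sum.elim (fun _ => (diaTop : Fm V)) fun _ => .bot))
  -- Deep enough for both sides of the equation at layer `n`.
  set n := max m₁ m₂
  rw [← hm₁ n n (le_max_left _ _) le_rfl a, ← hm₂ n n (le_max_right _ _) le_rfl a]
  set val' : V → Set (W × ℕ) := fun x => {p | p.1 ∈ val x}
  have hentails : (globalK.{u, w} V).Entails
      (Finset.univ.image fun _ : Fin 1 => Fm.and diaTop (boxBot (n + 1))) .bot := by
    intro W' _ R' val₀ hΓ b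
    have hb := hΓ _ (Finset.mem_image_of_mem _ (Finset.mem_univ 0))
    exact not_sat_boxBot R' val₀ (fun c => sat_diaTop.1 (hb c).1) (n + 1) b (hb b).2
  obtain ⟨_, rfl, hsat⟩ := (hΘ 1 _ _).1 hentails
  have : Nonempty W := ⟨a⟩
  have heq := @hsat ε hε (Set (W × ℕ)) (complexAlg (layeredRel R n)) (hcomplex _ _) val'
  have hmem := Set.ext_iff.1 heq (a, n)
  rw [mem_eval_complexAlg, mem_eval_complexAlg, sat_eval, sat_eval] at hmem
  rw [sat_eval, sat_eval]
  -- The extra conjunct is true at every world of the layered frame, so both substitutions induce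
  -- the same valuation.
  have hval : (fun x : EqVar 1 => {b | Sat (layeredRel R n) val' b
        (Sum.elim (fun _ => Fm.and diaTop (boxBot (n + 1))) (fun _ => Fm.bot) x)}) =
      fun x : EqVar 1 => {b | Sat (layeredRel R n) val' b
        (Sum.elim (fun _ => diaTop) (fun _ => Fm.bot) x)} := by
    funext x
    rcases x with x | x
    · ext b
      exact and_iff_left (sat_boxBot_layeredRel R n val' b)
    · rfl
  rwa [hval] at hmem

end ModalEDC

theorem mainTheorem10 (V : Type u) [Infinite V] :
    ¬ ModalEDC.Logic.HasStandardGlobalEDC.{u, w} (ModalEDC.globalK.{u, w} V) ∧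
    ¬ ModalEDC.Logic.HasGlobalEDC (ModalEDC.globalK.{u, w} V) ModalEDC.BAO.{w} :=
  ⟨ModalEDC.not_hasGlobalEDC V _ (fun _ _ hA h _ _ hφψ => hφψ.eval_eq_of_alg hA h)
      fun _ _ R => ModalEDC.alg_complexAlg V R,
    ModalEDC.not_hasGlobalEDC V _ (fun _ _ hA h _ _ hφψ => hφψ.eval_eq_of_bao hA h)
      fun _ _ R => ModalEDC.bao_complexAlg R⟩
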